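/- Let $\varepsilon>0$. The initial value problem $$\varphi_t+\rho+\varepsilon\left(\frac{1+\rho^2\varphi_{\rho\rho}}{(1-\rho\varphi_\rho)^2}-1\right)=0\quad(t\ge 0),\qquad \varphi(0,\rho)=0,$$ has a unique formal power series solution $\varphi(t,\rho)=\sum_{n\ge1}\beta_n(t)\rho^n$ with (complex-valued) coefficients $\beta_n$ of class $C^1$ on $[0,\infty)$; here the equation is read coefficient by coefficient in $\rho$. Write $\beta_n=\beta_n^{(\varepsilon)}$ and, with $\eta=e^{-2\varepsilon t}$, $$R(\varepsilon,t)=2\varepsilon\,\frac{2+\sqrt{1-\eta}-2\sqrt{1-\eta/2+\sqrt{1-\eta}}}{1-\eta^2}\quad(t>0),\qquad R(\varepsilon,0)=+\infty .$$ Then, for all $\varepsilon>0$, $t\ge0$ and $\rho\in\mathbb C$ with $|\rho|<R(\varepsilon,t)$, the series $\sum_{n\ge1}\beta_n^{(\varepsilon)}(t)\rho^n$ converges absolutely; its partial sums converge uniformly on the set of all such triples $(\varepsilon,t,\rho)$, in particular uniformly in $\varepsilon$; and for each $\varepsilon>0$ its sum $\varphi(t,\rho)$ has the partial derivatives $\varphi_t$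 (one-sided at $t=0$), $\varphi_\rho$, $\varphi_{\rho\rho}$ at every $(t,\rho)$ with $t\ge0$, $|\rho|<R(\varepsilon,t)$, satisfies $\rho\varphi_\rho\ne1$ there, and solves the equation there. -/

import Mathlib

/-- The coefficientwise (one-sided at `t = 0`) time derivative, at time `t ≥ 0`, of a
time-dependent formal power series `φ(t, ρ) = ∑ βₙ(t) ρⁿ`. -/
noncomputable def timeDeriv (φ : ℝ → PowerSeries ℂ) (t : ℝ) : PowerSeries ℂ :=
  PowerSeries.mk fun n => derivWithin (fun s => PowerSeries.coeff n (φ s)) (Set.Ici 0) t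

/-- `φ(t, ρ) = ∑_{n ≥ 1} βₙ(t) ρⁿ` is a formal power series in `ρ`, with coefficients of class
`C¹` on `[0, ∞)`, which satisfies
`φ_t + ρ + ε ((1 + ρ² φ_ρρ) / (1 - ρ φ_ρ)² - 1) = 0` for `t ≥ 0` and `φ(0, ρ) = 0`.
The series `(1 - ρ φ_ρ)²` has constant coefficient `1`, so its inverse is a genuine one. -/
structure IsFormalSolution (ε : ℝ) (φ : ℝ → PowerSeries ℂ) : Prop where
  constCoeff_zero : ∀ t, 0 ≤ t → PowerSeries.coeff 0 (φ t) = 0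
  contDiffOn : ∀ n, ContDiffOn ℝ 1 (fun t => PowerSeries.coeff n (φ t)) (Set.Ici 0)
  initial : φ 0 = 0
  equation : ∀ t, 0 ≤ t →
    timeDeriv φ t + PowerSeries.X
      + PowerSeries.C (ε : ℂ) *
        ((1 + PowerSeries.X ^ 2 * PowerSeries.derivative ℂ (PowerSeries.derivative ℂ (φ t)))
          * ((1 - PowerSeries.X * PowerSeries.derivative ℂ (φ t)) ^ 2)⁻¹ - 1) = 0

/-- The function `u(t, ρ)` of `t ≥ 0` and complex `ρ` has the partial derivatives `u_t`, `u_ρ`,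
`u_ρρ` at `(t, ρ)`, the denominator does not vanish there, and the equation
`u_t + ρ + ε ((1 + ρ² u_ρρ) / (1 - ρ u_ρ)² - 1) = 0` holds there. -/
def SolvesEquationAt (ε : ℝ) (u : ℝ → ℂ → ℂ) (t : ℝ) (ρ : ℂ) : Prop :=
  ∃ ut uρ uρρ : ℂ,
    HasDerivWithinAt (fun s => u s ρ) ut (Set.Ici 0) t ∧
    HasDerivAt (u t) uρ ρ ∧
    HasDerivAt (deriv (u t)) uρρ ρ ∧
    1 - ρ * uρ ≠ 0 ∧
    ut + ρ + (ε : ℂ) * ((1 + ρ ^ 2 * uρρ) / (1 - ρ * uρ) ^ 2 - 1) = 0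

/-- The sum at `ρ` of the power series `f`. -/
noncomputable def seriesSum (f : PowerSeries ℂ) (ρ : ℂ) : ℂ :=
  ∑' n, PowerSeries.coeff n f * ρ ^ n

/-- The bound on `|ρ|`, for `t > 0`. -/
noncomputable def radiusBound (ε t : ℝ) : ℝ :=
  2 * ε * (2 + √(1 - Real.exp (-2 * ε * t))
      - 2 * √(1 - Real.exp (-2 * ε * t) / 2 + √(1 - Real.exp (-2 * ε * t))))
    / (1 - Real.exp (-4 * ε * t))

/-- The triples `(ε, t, ρ)` with `ε > 0`, `t ≥ 0` and `|ρ|` below the bound. The bound tends to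
`+∞` as `t → 0`, and at `t = 0`, where its formula reads `0 / 0`, it imposes no condition. -/
def convergenceDomain : Set (ℝ × ℝ × ℂ) :=
  {p | 0 < p.1 ∧ 0 ≤ p.2.1 ∧ (p.2.1 = 0 ∨ ‖p.2.2‖ < radiusBound p.1 p.2.1)}

/-! Put p = ρφ_ρ and q = p/(1-p). The nonlinearity is ∂_ρ(ρq) (`nonlinearity_eq`), so β_n' =
-(δ_{n1} + ε(n+1)q_n), where q_n is nβ_n plus a convolution of the kβ_k with the q_m for k, m < n.
This is a triangular system of linear ODEs with damping rate εn(n+1), so existence and uniqueness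
follow degree by degree.

For convergence, let σ = 1 - e^{-2εt} and l = σ/(2ε). Then |nβ_n| ≤ f_n(σ)l^n and |q_n| ≤ g_n(σ)l^n
(`norm_coeff_le`): the polynomials f_n are chosen so that f_n(σ)l^n/n is a supersolution of the n-th
ODE (`differential_inequality`), while their generating functions stay algebraic, with G = F/(1-F)
and G = 2F - y + (1-σ)y²/(1-y). The discriminant of the resulting quadratic vanishes at y =
(√2-1)/(√2+√σ), where F ≤ 1/2 (`sum_range_le`); for t > 0, the condition l|ρ| < y is exactly |ρ| < R
(`radiusBound_mul_inverseRadius`).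

The outcome Σ n|β_n||ρ|^n ≤ 1/2 gives absolute convergence, a tail of at most 1/(2N) whatever ε, t
and ρ are, and |ρφ_ρ| ≤ 1/2, so the denominator does not vanish. The bound on q_n controls β_n' and
allows termwise differentiation in time; the formal equation then passes to the sums. -/

/-! ### Majorant polynomials -/

theorem exists_strong_recursion {α : Type*} [Zero α] (H : ℕ → (ℕ → α) → α) :
    ∃ s : ℕ → α, ∀ n, s n = H n (fun m => if m < n then s m else 0) := by
  refine ⟨fun n => Nat.strongRec (motive := fun _ => α)
    (fun n ih => H n (fun m => if h : m < n then ih m h else 0)) n, fun n => ?_⟩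
  simp only []
  rw [Nat.strongRec_eq]
  congr 1

/-- A sum over the antidiagonal of `n` only involves the entries below `n` when both factors
vanish at `0`. -/
theorem sum_antidiagonal_truncate {R : Type*} [Semiring R] {a b : ℕ → R} (ha : a 0 = 0)
    (hb : b 0 = 0) (n : ℕ) :
    ∑ x ∈ Finset.HasAntidiagonal.antidiagonal n,
        (if x.1 < n then a x.1 else 0) * (if x.2 < n then b x.2 else 0)
      = ∑ x ∈ Finset.HasAntidiagonal.antidiagonal n, a x.1 * b x.2 := by
  refine Finset.sum_congr rfl fun x hx => ?_
  rw [Finset.HasAntidiagonal.mem_antidiagonal] at hx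
  rcases Nat.eq_zero_or_pos x.1 with h1 | h1
  · simp [h1, ha]
  rcases Nat.eq_zero_or_pos x.2 with h2 | h2
  · simp [h2, hb]
  rw [if_pos (by omega), if_pos (by omega)]

/-- The sequences of polynomials `f n`, `g n` which dominate the coefficients of `ρ φ_ρ` and of
`ρ φ_ρ / (1 - ρ φ_ρ)`, up to rescaling. -/
structure IsMajorantPair (f g : ℕ → Polynomial ℝ) : Prop where
  f_zero : f 0 = 0
  g_zero : g 0 = 0
  f_one : f 1 = 1
  f_rec : ∀ n, 2 ≤ n →
    f n = ∑ x ∈ Finset.HasAntidiagonal.antidiagonal n, f x.1 * g x.2 - (1 - Polynomial.X)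
  g_rec : ∀ n, g n = f n + ∑ x ∈ Finset.HasAntidiagonal.antidiagonal n, f x.1 * g x.2

theorem exists_isMajorantPair : ∃ f g : ℕ → Polynomial ℝ, IsMajorantPair f g := by
  obtain ⟨s, hs⟩ := exists_strong_recursion (α := Polynomial ℝ × Polynomial ℝ)
    (fun n s =>
      let S := ∑ x ∈ Finset.HasAntidiagonal.antidiagonal n, (s x.1).1 * (s x.2).2
      let F := if n = 0 then 0 else if n = 1 then 1 else S - (1 - Polynomial.X)
      (F, F + S))
  have h0 : s 0 = 0 := by rw [hs 0]; simp
  have key : ∀ n, ∑ x ∈ Finset.HasAntidiagonal.antidiagonal n,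
        (if x.1 < n then s x.1 else 0).1 * (if x.2 < n then s x.2 else 0).2
      = ∑ x ∈ Finset.HasAntidiagonal.antidiagonal n, (s x.1).1 * (s x.2).2 := by
    intro n
    rw [← sum_antidiagonal_truncate (a := fun i => (s i).1) (b := fun i => (s i).2)
      (by simp [h0]) (by simp [h0])]
    refine Finset.sum_congr rfl fun x _ => ?_
    congr 1 <;> split_ifs <;> rfl
  simp only [key] at hs
  have hf : ∀ n, (s n).1 = if n = 0 then 0 else if n = 1 then 1 else
      ∑ x ∈ Finset.HasAntidiagonal.antidiagonal n, (s x.1).1 * (s x.2).2 - (1 - Polynomial.X) := by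
    intro n
    conv_lhs => rw [hs n]
  refine ⟨fun n => (s n).1, fun n => (s n).2, ?_, ?_, ?_, ?_, ?_⟩
  · simp [h0]
  · simp [h0]
  · simp only [hf 1]; simp
  · intro n hn
    rw [hf n, if_neg (by omega), if_neg (by omega)]
  · intro n
    rw [hf n]
    conv_lhs => rw [hs n]

namespace IsMajorantPair

variable {f g : ℕ → Polynomial ℝ}

theorem g_one (h : IsMajorantPair f g) : g 1 = 1 := by
  rw [h.g_rec, h.f_one]
  simp [Finset.Nat.sum_antidiagonal_eq_sum_range_succ_mk, Finset.sum_range_succ, h.f_zero,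
    h.g_zero]

theorem g_eq (h : IsMajorantPair f g) {n : ℕ} (hn : 2 ≤ n) :
    g n = 2 * f n + (1 - Polynomial.X) := by
  have h1 := h.f_rec n hn
  have h2 := h.g_rec n
  linear_combination h2 - h1

theorem f_two (h : IsMajorantPair f g) : f 2 = Polynomial.X := by
  rw [h.f_rec 2 le_rfl]
  simp [Finset.Nat.sum_antidiagonal_eq_sum_range_succ_mk, Finset.sum_range_succ, h.f_zero,
    h.g_zero, h.f_one, h.g_one]

/-- For n ≥ 3 the terms (1, n-1) and (n-1, 1) of the convolution alone contribute 3f_{n-1} + (1-σ),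
and the last summand cancels the subtracted 1-σ. So both the value and the derivative at least
triple at each step, and 3(n-1) ≥ n. -/
theorem bounds (h : IsMajorantPair f g) {σ : ℝ} (h0 : 0 ≤ σ) (h1 : σ ≤ 1) (n : ℕ) (hn : 2 ≤ n) :
    n / 2 * σ ≤ (f n).eval σ ∧ (n / 2 : ℝ) ≤ (f n).derivative.eval σ := by
  induction n using Nat.strong_induction_on with
  | _ n ih =>
  rcases hn.eq_or_lt with rfl | hn3
  · simp [h.f_two]
  have fnn : ∀ m < n, 0 ≤ (f m).eval σ ∧ 0 ≤ (f m).derivative.eval σ ∧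
      0 ≤ (g m).eval σ ∧ 0 ≤ (g m).derivative.eval σ := by
    intro m hm
    rcases Nat.lt_or_ge m 2 with hm2 | hm2
    · interval_cases m
      · simp [h.f_zero, h.g_zero]
      · simp [h.f_one, h.g_one]
    · obtain ⟨a, b⟩ := ih m hm hm2
      have hm' : (2 : ℝ) ≤ m := by exact_mod_cast hm2
      have : 0 ≤ (m : ℝ) / 2 * σ := by positivity
      refine ⟨by linarith, by linarith, ?_, ?_⟩
      · rw [h.g_eq hm2]; simp; linarith
      · rw [h.g_eq hm2]; simp; linarith
  obtain ⟨a, b⟩ := ih (n - 1) (by omega) (by omega)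
  have hc : ((n - 1 : ℕ) : ℝ) = n - 1 := by push_cast [show 1 ≤ n by omega]; ring
  have hn3' : (3 : ℝ) ≤ n := by exact_mod_cast hn3
  rw [hc] at a b
  have hsub : ({(1, n - 1), (n - 1, 1)} : Finset (ℕ × ℕ)) ⊆ Finset.HasAntidiagonal.antidiagonal n := by
    intro x hx
    simp only [Finset.mem_insert, Finset.mem_singleton] at hx
    rw [Finset.HasAntidiagonal.mem_antidiagonal]
    rcases hx with rfl | rfl <;> simp only [] <;> omega
  have hne : ((1, n - 1) : ℕ × ℕ) ≠ (n - 1, 1) := by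
    intro h; rw [Prod.mk.injEq] at h; omega
  have edge : ∀ x ∈ Finset.HasAntidiagonal.antidiagonal n, (x.1 < n ∧ x.2 < n) ∨ f x.1 = 0 ∨ g x.2 = 0 := by
    intro x hx
    rw [Finset.HasAntidiagonal.mem_antidiagonal] at hx
    rcases Nat.eq_zero_or_pos x.1 with h' | h'
    · simp [h', h.f_zero]
    rcases Nat.eq_zero_or_pos x.2 with h'' | h''
    · simp [h'', h.g_zero]
    · left; omega
  constructor
  · rw [h.f_rec n hn, Polynomial.eval_sub, Polynomial.eval_finsetSum]
    have := Finset.sum_le_sum_of_subset_of_nonneg (f := fun x => (f x.1 * g x.2).eval σ) hsub (by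
      intro x hx _
      rcases edge x hx with ⟨h1, h2⟩ | h1 | h1
      · rw [Polynomial.eval_mul]
        exact mul_nonneg (fnn _ h1).1 (fnn _ h2).2.2.1
      · simp [h1]
      · simp [h1])
    rw [Finset.sum_pair hne] at this
    simp only [h.f_one, h.g_one, one_mul, mul_one, h.g_eq (show 2 ≤ n - 1 by omega)] at this
    simp only [Polynomial.eval_add, Polynomial.eval_mul, Polynomial.eval_sub,
      Polynomial.eval_one, Polynomial.eval_X, Polynomial.eval_ofNat] at this ⊢
    nlinarith
  · rw [h.f_rec n hn, Polynomial.derivative_sub, Polynomial.derivative_sum, Polynomial.eval_sub,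
      Polynomial.eval_finsetSum]
    have := Finset.sum_le_sum_of_subset_of_nonneg
      (f := fun x => (f x.1 * g x.2).derivative.eval σ) hsub (by
      intro x hx _
      rcases edge x hx with ⟨h1, h2⟩ | h1 | h1
      · simp only [Polynomial.derivative_mul, Polynomial.eval_add, Polynomial.eval_mul]
        have A := fnn _ h1
        have B := fnn _ h2
        exact add_nonneg (mul_nonneg A.2.1 B.2.2.1) (mul_nonneg A.1 B.2.2.2)
      · simp [h1]
      · simp [h1])
    rw [Finset.sum_pair hne] at this
    simp only [h.f_one, h.g_one, one_mul, mul_one, h.g_eq (show 2 ≤ n - 1 by omega)] at this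
    simp at this ⊢
    nlinarith

theorem f_nonneg (h : IsMajorantPair f g) {σ : ℝ} (h0 : 0 ≤ σ) (h1 : σ ≤ 1) (n : ℕ) :
    0 ≤ (f n).eval σ := by
  rcases Nat.lt_or_ge n 2 with hn | hn
  · interval_cases n <;> simp [h.f_zero, h.f_one]
  · exact le_trans (by positivity) (h.bounds h0 h1 n hn).1

/-- The coefficients of the supersolution satisfy the differential inequality which makes it
dominate the formal solution. -/
theorem differential_inequality (h : IsMajorantPair f g) {ε l σ : ℝ} (hε : 0 < ε) (hl : 0 ≤ l)
    (hσ : σ = 2 * ε * l) (h1 : σ ≤ 1) {n : ℕ} (hn : 2 ≤ n) :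
    ε * (n + 1) * (l ^ n * ∑ x ∈ Finset.HasAntidiagonal.antidiagonal n,
        (f x.1).eval σ * (g x.2).eval σ)
      ≤ ε * (n + 1) * (l ^ n * (f n).eval σ)
        + (1 - σ) * (l ^ (n - 1) * (f n).eval σ
          + 2 * ε * (l ^ n * (f n).derivative.eval σ / n)) := by
  obtain ⟨a, b⟩ := h.bounds (by rw [hσ]; positivity) h1 n hn
  have hr : (f n).eval σ = ∑ x ∈ Finset.HasAntidiagonal.antidiagonal n,
      (f x.1).eval σ * (g x.2).eval σ - (1 - σ) := by
    conv_lhs => rw [h.f_rec n hn]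
    simp [Polynomial.eval_finsetSum]
  -- The claim is now 1-σ times ε(n+1)l^n ≤ l^{n-1}f_n + 2εl^n f_n'/n. The two parts of `bounds`
  -- supply εnl^n and εl^n, which is exactly enough.
  rw [show ∑ x ∈ Finset.HasAntidiagonal.antidiagonal n, (f x.1).eval σ * (g x.2).eval σ
    = (f n).eval σ + (1 - σ) by linarith]
  have hn0 : (0 : ℝ) < n := by exact_mod_cast (by omega : 0 < n)
  have e1 : l ^ (n - 1) * (n / 2 * σ) ≤ l ^ (n - 1) * (f n).eval σ := by gcongr
  have e2 : l ^ n * (n / 2) / n ≤ l ^ n * (f n).derivative.eval σ / n := by gcongr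
  have e3 : l ^ (n - 1) * (n / 2 * σ) = ε * n * l ^ n := by
    conv_rhs => rw [show n = n - 1 + 1 by omega, pow_succ, show n - 1 + 1 = n by omega]
    rw [hσ]
    ring
  have e4 : l ^ n * (n / 2) / n = l ^ n / 2 := by field_simp
  rw [e3] at e1
  rw [e4] at e2
  have := mul_le_mul_of_nonneg_left (add_le_add e1 (mul_le_mul_of_nonneg_left e2
    (show 0 ≤ 2 * ε by positivity))) (show 0 ≤ 1 - σ by linarith)
  linarith

end IsMajorantPair

/-! ### Generating functions of the majorants -/

open PowerSeries in
-- Without constant terms, degrees up to N of the product involve only degrees below N of the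
-- factors. This gain of one degree drives the induction on truncations in `sum_range_le`.
theorem sum_range_coeff_mul_le {A B : PowerSeries ℝ} (hA : ∀ n, 0 ≤ coeff n A)
    (hB : ∀ n, 0 ≤ coeff n B) (hA0 : coeff 0 A = 0) (hB0 : coeff 0 B = 0) {y : ℝ} (hy : 0 ≤ y)
    (N : ℕ) :
    ∑ n ∈ Finset.range (N + 1), coeff n (A * B) * y ^ n
      ≤ (∑ n ∈ Finset.range N, coeff n A * y ^ n) * ∑ n ∈ Finset.range N, coeff n B * y ^ n := by
  rw [Finset.sum_mul_sum, ← Finset.sum_product']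
  have e : ∀ n, coeff n (A * B) * y ^ n = ∑ x ∈ Finset.HasAntidiagonal.antidiagonal n,
      coeff x.1 A * y ^ x.1 * (coeff x.2 B * y ^ x.2) := by
    intro n
    rw [coeff_mul, Finset.sum_mul]
    refine Finset.sum_congr rfl fun x hx => ?_
    rw [← Finset.HasAntidiagonal.mem_antidiagonal.1 hx, pow_add]
    ring
  rw [Finset.sum_congr rfl fun n _ => e n, ← Finset.sum_biUnion, ← Finset.sum_filter_ne_zero]
  · refine Finset.sum_le_sum_of_subset_of_nonneg ?_ ?_
    · intro x hx
      simp only [Finset.mem_filter, Finset.mem_biUnion, Finset.mem_range,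
        Finset.HasAntidiagonal.mem_antidiagonal] at hx
      obtain ⟨⟨n, hn, hx⟩, hne⟩ := hx
      have h1 : x.1 ≠ 0 := fun h => hne (by simp [h, hA0])
      have h2 : x.2 ≠ 0 := fun h => hne (by simp [h, hB0])
      simp only [Finset.mem_product, Finset.mem_range]
      omega
    · intro x _ _
      exact mul_nonneg (mul_nonneg (hA _) (by positivity)) (mul_nonneg (hB _) (by positivity))
  · intro a _ b _ hab
    refine Finset.disjoint_left.2 fun x h1 h2 => hab ?_
    rw [← Finset.HasAntidiagonal.mem_antidiagonal.1 h1, Finset.HasAntidiagonal.mem_antidiagonal.1 h2]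

open PowerSeries in
-- Shifting by X and truncating loses only the top term, which is nonnegative and enters with a
-- minus sign.
theorem mul_sum_range_le_sum_range_one_sub_mul {A : PowerSeries ℝ} (hA : ∀ n, 0 ≤ coeff n A)
    {y : ℝ} (hy : 0 ≤ y) (N : ℕ) :
    (1 - y) * ∑ n ∈ Finset.range N, coeff n A * y ^ n
      ≤ ∑ n ∈ Finset.range N, coeff n ((1 - X) * A) * y ^ n := by
  rcases N with _ | N
  · simp
  have h1 : ∑ n ∈ Finset.range (N + 1), coeff n (X * A) * y ^ n
      = y * ∑ n ∈ Finset.range N, coeff n A * y ^ n := by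
    rw [Finset.sum_range_succ', Finset.mul_sum]
    simp only [coeff_succ_X_mul, coeff_zero_X_mul, zero_mul, add_zero]
    exact Finset.sum_congr rfl fun n _ => by ring
  have h2 : y * ∑ n ∈ Finset.range N, coeff n A * y ^ n
      ≤ y * ∑ n ∈ Finset.range (N + 1), coeff n A * y ^ n := by
    refine mul_le_mul_of_nonneg_left ?_ hy
    rw [Finset.sum_range_succ]
    exact le_add_of_nonneg_right (mul_nonneg (hA _) (by positivity))
  simp only [sub_mul, one_mul, map_sub, Finset.sum_sub_distrib]
  rw [h1]
  linarith

namespace IsMajorantPair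

variable {f g : ℕ → Polynomial ℝ}

open PowerSeries in
/-- The dominating series is bounded by `1 / 2` up to the radius `(√2 - 1) / (√2 + s)`, where
`σ = s ^ 2`. -/
theorem sum_range_le (h : IsMajorantPair f g) {s : ℝ} (h0 : 0 < s) (h1 : s ≤ 1) (N : ℕ) :
    ∑ n ∈ Finset.range N, (f n).eval (s ^ 2) * ((√2 - 1) / (√2 + s)) ^ n ≤ 1 / 2 := by
  have hσ0 : 0 ≤ s ^ 2 := by positivity
  have hσ1 : s ^ 2 ≤ 1 := by nlinarith
  set σ := s ^ 2 with hσ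
  obtain ⟨F, hF⟩ : ∃ F : PowerSeries ℝ, F = PowerSeries.mk fun n => (f n).eval σ := ⟨_, rfl⟩
  obtain ⟨G, hG⟩ : ∃ G : PowerSeries ℝ, G = PowerSeries.mk fun n => (g n).eval σ := ⟨_, rfl⟩
  obtain ⟨I, hI⟩ : ∃ I : PowerSeries ℝ, I = PowerSeries.mk 1 := ⟨_, rfl⟩
  have hIX : I * (1 - X) = 1 := hI ▸ mk_one_mul_one_sub_eq_one ℝ
  have eG : G = F + F * G := by
    ext n
    rw [map_add, coeff_mul, hF, hG]
    simp only [coeff_mk]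
    conv_lhs => rw [h.g_rec n]
    simp [Polynomial.eval_finsetSum]
  have eG' : G = 2 * F - X + (1 - σ) • (X ^ 2 * I) := by
    ext n
    rw [two_mul]
    rcases n with _ | _ | n
    · simp [hF, hG, h.f_zero, h.g_zero]
    · simp [hF, hG, h.f_one, h.g_one, coeff_X_pow_mul', coeff_X]
    · simp only [map_add, map_sub, coeff_smul, coeff_X_pow_mul', coeff_X, hF, hG, hI, coeff_mk,
        h.g_eq (show 2 ≤ n + 1 + 1 by omega)]
      simp
      ring
  -- The equations for F and G contain subtractions. For D = (F-X)/(1-X) and E = (1-X)G - X they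
  -- become E = D + DE and 2(1-X)²D = σX² + E, and P, D, E all have nonnegative coefficients.
  obtain ⟨P, hP⟩ : ∃ P : PowerSeries ℝ, P = F - X := ⟨_, rfl⟩
  obtain ⟨D, hD⟩ : ∃ D : PowerSeries ℝ, D = P * I := ⟨_, rfl⟩
  obtain ⟨E, hE⟩ : ∃ E : PowerSeries ℝ, E = G * (1 - X) - X := ⟨_, rfl⟩
  have hP1 : P = (1 - X) * D := by
    rw [hD]; linear_combination (-P) * hIX
  have eE : E = D + D * E := by
    have : (1 - X) * D = F - X := by rw [← hP1, hP]
    rw [hE]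
    linear_combination eG - (G + 1) * this
  have eP : (2 : ℝ) • ((1 - X) * P) = σ • X ^ 2 + E := by
    rw [smul_eq_C_mul, smul_eq_C_mul, hE, hP, eG', smul_eq_C_mul]
    have : C (1 - σ) = (1 : PowerSeries ℝ) - C σ := by simp
    rw [this, show (C (2 : ℝ) : PowerSeries ℝ) = 2 from map_ofNat _ 2]
    linear_combination (-(1 - C σ) * X ^ 2) * hIX
  have hP_nonneg : ∀ n, 0 ≤ coeff n P := by
    intro n
    rcases n with _ | _ | n
    · simp [hP, hF, h.f_zero]
    · simp [hP, hF, h.f_one]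
    · simpa [hP, hF, coeff_X] using h.f_nonneg hσ0 hσ1 (n + 1 + 1)
  have hD_eq : ∀ n, coeff n D = ∑ x ∈ Finset.HasAntidiagonal.antidiagonal n, coeff x.1 P := by
    intro n
    rw [hD, coeff_mul]
    simp [hI]
  have hD_nonneg : ∀ n, 0 ≤ coeff n D := by
    intro n
    rw [hD_eq]
    exact Finset.sum_nonneg fun x _ => hP_nonneg _
  have hPD : ∀ n, coeff n P ≤ coeff n D := by
    intro n
    rw [hD_eq]
    exact Finset.single_le_sum (f := fun x : ℕ × ℕ => coeff x.1 P) (fun x _ => hP_nonneg _)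
      (show (n, 0) ∈ _ by simp)
  have hD0 : coeff 0 D = 0 := by
    rw [hD_eq]; simp [hP, hF, h.f_zero]
  have hE0 : coeff 0 E = 0 := by
    simp [hE, hG, h.g_zero]
  have hE_nonneg : ∀ n, 0 ≤ coeff n E := by
    intro n
    induction n using Nat.strong_induction_on with
    | _ n ih =>
    rw [eE, map_add, coeff_mul]
    refine add_nonneg (hD_nonneg n) (Finset.sum_nonneg fun x hx => ?_)
    rw [Finset.HasAntidiagonal.mem_antidiagonal] at hx
    rcases Nat.eq_zero_or_pos x.1 with hx1 | hx1
    · simp [hx1, hD0]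
    · exact mul_nonneg (hD_nonneg _) (ih _ (by omega))
  have h2 : √2 * √2 = 2 := Real.mul_self_sqrt (by norm_num)
  have h2a : 1.414 < √2 := Real.lt_sqrt_of_sq_lt (by norm_num)
  have h2b : √2 < 1.415 := (Real.sqrt_lt' (by norm_num)).2 (by norm_num)
  set y := (√2 - 1) / (√2 + s) with hy
  have hy0 : 0 ≤ y := div_nonneg (by linarith) (by linarith)
  have hys : y * (√2 + s) = √2 - 1 := by rw [hy]; field_simp
  have hy1 : 1 - y = (1 + s) / (√2 + s) := by rw [hy]; field_simp; ring
  -- Eliminating E leaves a quadratic in D whose discriminant vanishes when √2(1-y) = 1 + sy, which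
  -- determines y. Its double root is D₀ = sy/(√2(1-y)), and then E₀ = sy.
  set D₀ := s * (√2 - 1) / (√2 * (1 + s)) with hD₀
  set E₀ := s * (√2 - 1) / (√2 + s) with hE₀
  have hD₀0 : 0 ≤ D₀ := div_nonneg (mul_nonneg h0.le (by linarith)) (by positivity)
  have hE₀0 : 0 ≤ E₀ := div_nonneg (mul_nonneg h0.le (by linarith)) (by positivity)
  have fixE : E₀ = D₀ + D₀ * E₀ := by
    rw [hD₀, hE₀]; field_simp
    ring
  have fixD : 2 * (1 - y) ^ 2 * D₀ = σ * y ^ 2 + E₀ := by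
    rw [hy1, hy, hD₀, hE₀, hσ]; field_simp
    linear_combination (1 + s) * (1 - √2) * h2
  have hV : 1 < 2 * (1 - y) ^ 2 := by
    have : 1 < √2 * (1 - y) := by
      rw [hy1, ← mul_div_assoc, lt_div_iff₀ (by positivity)]
      nlinarith
    nlinarith
  -- Compare truncations with the fixed point (D₀, E₀). The product DE uses only the previous
  -- truncation; the `SD` of the current degree that enters through `SE` is absorbed on the left
  -- because 2(1-y)² > 1.
  have main : ∀ N, ∑ n ∈ Finset.range N, coeff n D * y ^ n ≤ D₀ ∧
      ∑ n ∈ Finset.range N, coeff n E * y ^ n ≤ E₀ := by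
    intro N
    induction N with
    | zero => simp [hD₀0, hE₀0]
    | succ N ih =>
    obtain ⟨i1, i2⟩ := ih
    set SD := ∑ n ∈ Finset.range (N + 1), coeff n D * y ^ n with hSD
    set SE := ∑ n ∈ Finset.range (N + 1), coeff n E * y ^ n with hSE
    have a1 : SE ≤ SD + D₀ * E₀ := by
      have : SE = SD + ∑ n ∈ Finset.range (N + 1), coeff n (D * E) * y ^ n := by
        rw [hSE, hSD, ← Finset.sum_add_distrib]
        refine Finset.sum_congr rfl fun n _ => ?_
        conv_lhs => rw [eE]
        rw [map_add, add_mul]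
      rw [this]
      refine add_le_add_right ((sum_range_coeff_mul_le hD_nonneg hE_nonneg hD0 hE0 hy0 N).trans
        (mul_le_mul i1 i2 (Finset.sum_nonneg fun n _ => mul_nonneg (hE_nonneg n) (by positivity))
          hD₀0)) _
    have a2 : (1 - y) * SD ≤ ∑ n ∈ Finset.range (N + 1), coeff n P * y ^ n := by
      rw [hP1]
      exact mul_sum_range_le_sum_range_one_sub_mul hD_nonneg hy0 _
    have a3 := mul_sum_range_le_sum_range_one_sub_mul hP_nonneg hy0 (N + 1)
    have a4 : 2 * ∑ n ∈ Finset.range (N + 1), coeff n ((1 - X) * P) * y ^ n ≤ σ * y ^ 2 + SE := by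
      have : 2 * ∑ n ∈ Finset.range (N + 1), coeff n ((1 - X) * P) * y ^ n
          = σ * ∑ n ∈ Finset.range (N + 1), coeff n (X ^ 2 : PowerSeries ℝ) * y ^ n + SE := by
        rw [hSE, Finset.mul_sum, Finset.mul_sum, ← Finset.sum_add_distrib]
        refine Finset.sum_congr rfl fun n _ => ?_
        have := congrArg (coeff n) eP
        simp only [map_add, coeff_smul] at this
        linear_combination y ^ n * this
      rw [this]
      gcongr
      simp only [coeff_X_pow, ite_mul, one_mul, zero_mul, Finset.sum_ite_eq', Finset.mem_range]
      split_ifs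
      · exact le_rfl
      · positivity
    have hyp : 0 ≤ 1 - y := by rw [hy1]; positivity
    have a5 := mul_le_mul_of_nonneg_left a2 hyp
    have a6 : (2 * (1 - y) ^ 2 - 1) * SD ≤ (2 * (1 - y) ^ 2 - 1) * D₀ := by
      nlinarith
    have a7 : SD ≤ D₀ := le_of_mul_le_mul_left a6 (by linarith)
    exact ⟨a7, by linarith⟩
  have hFle : ∑ n ∈ Finset.range N, (f n).eval σ * y ^ n
      ≤ ∑ n ∈ Finset.range N, coeff n (X : PowerSeries ℝ) * y ^ n
        + ∑ n ∈ Finset.range N, coeff n D * y ^ n := by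
    rw [← Finset.sum_add_distrib]
    refine Finset.sum_le_sum fun n _ => ?_
    rw [← add_mul]
    refine mul_le_mul_of_nonneg_right ?_ (by positivity)
    have := hPD n
    rw [hP, map_sub, hF, coeff_mk] at this
    linarith
  have hX : ∑ n ∈ Finset.range N, coeff n (X : PowerSeries ℝ) * y ^ n ≤ y := by
    simp only [coeff_X, ite_mul, one_mul, zero_mul, Finset.sum_ite_eq', Finset.mem_range]
    split_ifs
    · simp
    · exact hy0
  have b1 : y ≤ 0.3 := by
    rw [hy, div_le_iff₀ (by positivity)]; linarith
  have b2 : D₀ ≤ 0.2 := by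
    rw [hD₀, div_le_iff₀ (by positivity)]; nlinarith
  linarith [(main N).1]

end IsMajorantPair

/-! ### The equation in divergence form, coefficient by coefficient -/

/-- The series `ρ φ_ρ / (1 - ρ φ_ρ)`. -/
noncomputable def fluxSeries (φ : PowerSeries ℂ) : PowerSeries ℂ :=
  (PowerSeries.X * PowerSeries.derivative ℂ φ) *
    (1 - PowerSeries.X * PowerSeries.derivative ℂ φ)⁻¹

section Formal

open PowerSeries

theorem coeff_X_mul_derivative (φ : PowerSeries ℂ) (n : ℕ) :
    coeff n (X * derivative ℂ φ) = n * coeff n φ := by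
  rcases n with _ | n
  · simp
  · rw [coeff_succ_X_mul, coeff_derivative]; push_cast; ring

theorem constantCoeff_one_sub_X_mul_ne_zero (φ : PowerSeries ℂ) :
    constantCoeff (1 - X * φ) ≠ 0 := by simp

theorem fluxSeries_mul (φ : PowerSeries ℂ) :
    fluxSeries φ * (1 - X * derivative ℂ φ) = X * derivative ℂ φ := by
  rw [fluxSeries, mul_assoc, PowerSeries.inv_mul_cancel _ (constantCoeff_one_sub_X_mul_ne_zero _),
    mul_one]

theorem coeff_fluxSeries (φ : PowerSeries ℂ) (n : ℕ) :
    coeff n (fluxSeries φ) = n * coeff n φ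
      + ∑ x ∈ Finset.HasAntidiagonal.antidiagonal n,
        (x.1 * coeff x.1 φ) * coeff x.2 (fluxSeries φ) := by
  have h : fluxSeries φ = X * derivative ℂ φ + X * derivative ℂ φ * fluxSeries φ := by
    linear_combination fluxSeries_mul φ
  conv_lhs => rw [h]
  rw [map_add, coeff_X_mul_derivative, coeff_mul]
  simp only [coeff_X_mul_derivative]

theorem coeff_zero_fluxSeries (φ : PowerSeries ℂ) : coeff 0 (fluxSeries φ) = 0 := by
  rw [coeff_fluxSeries]; simp

/-- The nonlinearity is in divergence form. -/
theorem nonlinearity_eq (φ : PowerSeries ℂ) :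
    (1 + X ^ 2 * derivative ℂ (derivative ℂ φ)) * ((1 - X * derivative ℂ φ) ^ 2)⁻¹ - 1
      = derivative ℂ (X * fluxSeries φ) := by
  have h := fluxSeries_mul φ
  -- Differentiating q(1-p) = p avoids differentiating an inverse; the claim is a polynomial
  -- combination of this relation and its derivative.
  have h' := congrArg (derivative ℂ) h
  simp only [Derivation.leibniz, map_sub, smul_eq_mul, derivative_X, Derivation.map_one_eq_zero]
    at h'
  rw [sub_eq_iff_eq_add, eq_comm, PowerSeries.eq_mul_inv_iff_mul_eq (by simp)]
  simp only [Derivation.leibniz, smul_eq_mul, derivative_X]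
  linear_combination (1 - X * derivative ℂ φ) * X * h' + (1 - X * derivative ℂ φ
    + X * (derivative ℂ φ + X * derivative ℂ (derivative ℂ φ))) * h

theorem coeff_nonlinearity (φ : PowerSeries ℂ) (n : ℕ) :
    coeff n ((1 + X ^ 2 * derivative ℂ (derivative ℂ φ)) * ((1 - X * derivative ℂ φ) ^ 2)⁻¹ - 1)
      = (n + 1) * coeff n (fluxSeries φ) := by
  rw [nonlinearity_eq, coeff_derivative, coeff_succ_X_mul, mul_comm]

theorem equation_iff (ε : ℝ) (φ : PowerSeries ℂ) (d : PowerSeries ℂ) :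
    d + X + C (ε : ℂ) * ((1 + X ^ 2 * derivative ℂ (derivative ℂ φ))
          * ((1 - X * derivative ℂ φ) ^ 2)⁻¹ - 1) = 0 ↔
    ∀ n, coeff n d
      = -((if n = 1 then 1 else 0) + ε * (n + 1) * coeff n (fluxSeries φ)) := by
  rw [PowerSeries.ext_iff]
  refine forall_congr' fun n => ?_
  rw [map_add, map_add, coeff_C_mul, coeff_nonlinearity, coeff_X, map_zero]
  constructor <;> intro h
  · linear_combination h
  · linear_combination h

end Formal

/-! ### Uniqueness and coefficient bounds by ODE comparison -/

/-- The integrating factor e^{at} removes the linear term; what remains is a comparison of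
derivatives of e^{at}b and e^{at}c. -/
theorem norm_le_of_linear_ode {a : ℝ} {b r : ℝ → ℂ} {c c' : ℝ → ℝ}
    (hb : ∀ t, 0 ≤ t → HasDerivWithinAt b (-(a * b t + r t)) (Set.Ici 0) t) (hb0 : b 0 = 0)
    (hc : ∀ t, HasDerivAt c (c' t) t) (hc0 : 0 ≤ c 0)
    (hr : ∀ t, 0 ≤ t → ‖r t‖ ≤ c' t + a * c t) {t : ℝ} (ht : 0 ≤ t) : ‖b t‖ ≤ c t := by
  have hexp : ∀ s, HasDerivAt (fun s : ℝ => Real.exp (a * s)) (Real.exp (a * s) * a) s := by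
    intro s
    simpa using ((hasDerivAt_id s).const_mul a).exp
  have hf : ∀ s, 0 ≤ s → HasDerivWithinAt (fun s => Real.exp (a * s) • b s)
      (-(Real.exp (a * s) • r s)) (Set.Ici 0) s := by
    intro s hs
    refine ((hexp s).hasDerivWithinAt.smul (hb s hs)).congr_deriv ?_
    simp only [Complex.real_smul]
    push_cast
    ring
  have hB : ∀ s, HasDerivAt (fun s => Real.exp (a * s) * c s)
      (Real.exp (a * s) * (c' s + a * c s)) s := by
    intro s
    refine ((hexp s).mul (hc s)).congr_deriv ?_
    ring
  have := image_norm_le_of_norm_deriv_right_le_deriv_boundary (a := 0) (b := t)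
    (f := fun s => Real.exp (a * s) • b s) (f' := fun s => -(Real.exp (a * s) • r s))
    (B := fun s => Real.exp (a * s) * c s)
    (B' := fun s => Real.exp (a * s) * (c' s + a * c s))
    (fun s hs => (hf s hs.1).continuousWithinAt.mono Set.Icc_subset_Ici_self)
    (fun s hs => (hf s hs.1).mono (Set.Ici_subset_Ici.2 hs.1)) (by simp [hb0, hc0]) hB
    (fun s hs => by
      rw [norm_neg, norm_smul, Real.norm_of_nonneg (Real.exp_nonneg _)]
      exact mul_le_mul_of_nonneg_left (hr s hs.1) (Real.exp_nonneg _))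
    (Set.right_mem_Icc.2 ht)
  rw [norm_smul, Real.norm_of_nonneg (Real.exp_nonneg _)] at this
  exact le_of_mul_le_mul_left this (Real.exp_pos _)

namespace IsFormalSolution

open PowerSeries

variable {ε : ℝ} {φ ψ : ℝ → PowerSeries ℂ}

theorem hasDerivWithinAt_coeff (h : IsFormalSolution ε φ) (n : ℕ) {t : ℝ} (ht : 0 ≤ t) :
    HasDerivWithinAt (fun s => coeff n (φ s))
      (-((if n = 1 then 1 else 0) + ε * (n + 1) * coeff n (fluxSeries (φ t)))) (Set.Ici 0) t := by
  have h1 := ((h.contDiffOn n).differentiableOn one_ne_zero t ht).hasDerivWithinAt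
  have h2 := (equation_iff ε (φ t) (timeDeriv φ t)).1 (h.equation t ht) n
  rw [timeDeriv, coeff_mk] at h2
  rwa [h2] at h1

theorem hasDerivWithinAt_coeff' (h : IsFormalSolution ε φ) (n : ℕ) {t : ℝ} (ht : 0 ≤ t) :
    HasDerivWithinAt (fun s => coeff n (φ s))
      (-(((ε * n * (n + 1) : ℝ) : ℂ) * coeff n (φ t) + ((if n = 1 then 1 else 0)
        + ε * (n + 1) * ∑ x ∈ Finset.HasAntidiagonal.antidiagonal n,
          (x.1 * coeff x.1 (φ t)) * coeff x.2 (fluxSeries (φ t))))) (Set.Ici 0) t := by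
  refine (h.hasDerivWithinAt_coeff n ht).congr_deriv ?_
  rw [coeff_fluxSeries]
  push_cast
  ring

/-- Once lower degrees agree, the difference of the n-th coefficients solves a homogeneous linear
ODE with zero initial value. The flux coefficients must be carried along in the induction. -/
theorem unique (hφ : IsFormalSolution ε φ) (hψ : IsFormalSolution ε ψ) {t : ℝ} (ht : 0 ≤ t) :
    ψ t = φ t := by
  have key : ∀ n, ∀ t, 0 ≤ t → coeff n (ψ t) = coeff n (φ t) ∧
      coeff n (fluxSeries (ψ t)) = coeff n (fluxSeries (φ t)) := by
    intro n
    induction n using Nat.strong_induction_on with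
    | _ n ih =>
    have hK : ∀ t, 0 ≤ t → ∑ x ∈ Finset.HasAntidiagonal.antidiagonal n,
          (x.1 * coeff x.1 (ψ t)) * coeff x.2 (fluxSeries (ψ t))
        = ∑ x ∈ Finset.HasAntidiagonal.antidiagonal n,
          (x.1 * coeff x.1 (φ t)) * coeff x.2 (fluxSeries (φ t)) := by
      intro t ht
      refine Finset.sum_congr rfl fun x hx => ?_
      rw [Finset.HasAntidiagonal.mem_antidiagonal] at hx
      rcases Nat.eq_zero_or_pos x.1 with h1 | h1
      · simp [h1]
      rcases Nat.eq_zero_or_pos x.2 with h2 | h2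
      · rw [h2, coeff_zero_fluxSeries, coeff_zero_fluxSeries, mul_zero, mul_zero]
      rw [(ih x.1 (by omega) t ht).1, (ih x.2 (by omega) t ht).2]
    have hd : ∀ t, 0 ≤ t → coeff n (ψ t) = coeff n (φ t) := by
      intro t ht
      have := norm_le_of_linear_ode (a := ε * n * (n + 1))
        (b := fun t => coeff n (ψ t) - coeff n (φ t)) (r := fun _ => 0) (c := fun _ => 0)
        (c' := fun _ => 0)
        (fun t ht => by
          refine ((hψ.hasDerivWithinAt_coeff' n ht).sub
            (hφ.hasDerivWithinAt_coeff' n ht)).congr_deriv ?_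
          rw [hK t ht]
          ring)
        (by simp [hφ.initial, hψ.initial]) (fun t => hasDerivAt_const t 0) le_rfl
        (fun t _ => by simp) ht
      exact sub_eq_zero.1 (norm_le_zero_iff.1 this)
    intro t ht
    refine ⟨hd t ht, ?_⟩
    rw [coeff_fluxSeries, coeff_fluxSeries (φ t), hK t ht, hd t ht]
  ext n
  exact (key n t ht).1

variable {f g : ℕ → Polynomial ℝ}

theorem norm_coeff_le (h : IsFormalSolution ε φ) (hε : 0 < ε) (hfg : IsMajorantPair f g) (n : ℕ) :
    ∀ t, 0 ≤ t →
      ‖(n : ℂ) * coeff n (φ t)‖ ≤ (f n).eval (1 - Real.exp (-2 * ε * t))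
          * ((1 - Real.exp (-2 * ε * t)) / (2 * ε)) ^ n ∧
      ‖coeff n (fluxSeries (φ t))‖ ≤ (g n).eval (1 - Real.exp (-2 * ε * t))
          * ((1 - Real.exp (-2 * ε * t)) / (2 * ε)) ^ n := by
  set σ : ℝ → ℝ := fun t => 1 - Real.exp (-2 * ε * t) with hσ
  set l : ℝ → ℝ := fun t => σ t / (2 * ε) with hl
  have hσl : ∀ t, σ t = 2 * ε * l t := fun t => by rw [hl]; field_simp
  have hσ0 : ∀ t, 0 ≤ t → 0 ≤ σ t := by
    intro t ht
    have : Real.exp (-2 * ε * t) ≤ 1 := Real.exp_le_one_iff.2 (by nlinarith [mul_nonneg hε.le ht])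
    simp only [hσ]; linarith
  have hl0 : ∀ t, 0 ≤ t → 0 ≤ l t := fun t ht => div_nonneg (hσ0 t ht) (by positivity)
  have hσ1 : ∀ t, σ t ≤ 1 := by
    intro t
    have := Real.exp_pos (-2 * ε * t)
    simp only [hσ]; linarith
  have hσ' : ∀ t, HasDerivAt σ (2 * ε * (1 - σ t)) t := by
    intro t
    have h1 : HasDerivAt (fun t : ℝ => -2 * ε * t) (-2 * ε) t := by
      simpa using (hasDerivAt_id t).const_mul (-2 * ε)
    refine (h1.exp.const_sub 1).congr_deriv ?_
    simp only [hσ]; ring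
  have hl' : ∀ t, HasDerivAt l (1 - σ t) t := by
    intro t
    refine ((hσ' t).div_const (2 * ε)).congr_deriv ?_
    field_simp
  change ∀ t, 0 ≤ t → ‖(n : ℂ) * coeff n (φ t)‖ ≤ (f n).eval (σ t) * l t ^ n ∧
    ‖coeff n (fluxSeries (φ t))‖ ≤ (g n).eval (σ t) * l t ^ n
  induction n using Nat.strong_induction_on with
  | _ n ih =>
  have hK : ∀ t, 0 ≤ t → ‖∑ x ∈ Finset.HasAntidiagonal.antidiagonal n,
        (x.1 * coeff x.1 (φ t)) * coeff x.2 (fluxSeries (φ t))‖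
      ≤ l t ^ n * ∑ x ∈ Finset.HasAntidiagonal.antidiagonal n,
        (f x.1).eval (σ t) * (g x.2).eval (σ t) := by
    intro t ht
    rw [Finset.mul_sum]
    refine (norm_sum_le _ _).trans (Finset.sum_le_sum fun x hx => ?_)
    rw [Finset.HasAntidiagonal.mem_antidiagonal] at hx
    rcases Nat.eq_zero_or_pos x.1 with h1 | h1
    · simp [h1, hfg.f_zero]
    rcases Nat.eq_zero_or_pos x.2 with h2 | h2
    · rw [h2, coeff_zero_fluxSeries, hfg.g_zero]; simp
    have A := (ih x.1 (by omega) t ht).1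
    have B := (ih x.2 (by omega) t ht).2
    rw [norm_mul]
    refine (mul_le_mul A B (norm_nonneg _) ((norm_nonneg _).trans A)).trans_eq ?_
    rw [← hx, pow_add]
    ring
  have hp : ∀ t, 0 ≤ t → ‖(n : ℂ) * coeff n (φ t)‖ ≤ (f n).eval (σ t) * l t ^ n := by
    rcases Nat.eq_zero_or_pos n with rfl | hn
    · intro t ht
      simp [hfg.f_zero]
    intro t ht
    have hn' : (0 : ℝ) < n := by exact_mod_cast hn
    have := norm_le_of_linear_ode (c := fun t => (f n).eval (σ t) * l t ^ n / n)
      (c' := fun t => ((f n).derivative.eval (σ t) * (2 * ε * (1 - σ t)) * l t ^ n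
        + (f n).eval (σ t) * (n * l t ^ (n - 1) * (1 - σ t))) / n)
      (fun t ht => h.hasDerivWithinAt_coeff' n ht) (by simp [h.initial])
      (fun t => ((((f n).hasDerivAt (σ t)).comp t (hσ' t)).mul ((hl' t).pow n)).div_const _)
      (by simp [hl, hσ, hn.ne'])
      (fun t ht => by
        refine (norm_add_le _ _).trans ?_
        rw [norm_mul, norm_mul, Complex.norm_real, Real.norm_of_nonneg hε.le]
        have e : ‖(n : ℂ) + 1‖ = n + 1 := by exact_mod_cast Complex.norm_natCast (n + 1)
        rw [e]
        refine (add_le_add_right (mul_le_mul_of_nonneg_left (hK t ht) (by positivity)) _).trans ?_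
        -- In degree one the supersolution is exact: l' + 2εl = (1-σ) + σ = 1.
        rcases (show 1 ≤ n from hn).eq_or_lt with rfl | hn2
        · rw [hσl t]
          simp [hfg.f_one, Finset.Nat.sum_antidiagonal_eq_sum_range_succ_mk, Finset.sum_range_succ,
            hfg.f_zero, hfg.g_zero]
          linarith
        · rw [if_neg (by omega), norm_zero, zero_add]
          refine (hfg.differential_inequality hε (hl0 t ht) (hσl t) (hσ1 t) hn2).trans_eq ?_
          field_simp
          ring) ht
    rw [norm_mul, Complex.norm_natCast]
    rw [le_div_iff₀ hn'] at this
    linarith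
  intro t ht
  refine ⟨hp t ht, ?_⟩
  rw [coeff_fluxSeries]
  refine (norm_add_le _ _).trans ((add_le_add (hp t ht) (hK t ht)).trans_eq ?_)
  conv_rhs => rw [hfg.g_rec n]
  simp [Polynomial.eval_finsetSum]
  ring

end IsFormalSolution

/-! ### Existence of the formal solution -/

open PowerSeries in
theorem eq_fluxSeries_of_coeff {φ Q : PowerSeries ℂ}
    (h : ∀ n, coeff n Q = n * coeff n φ + ∑ x ∈ Finset.HasAntidiagonal.antidiagonal n,
        (x.1 * coeff x.1 φ) * coeff x.2 Q) : Q = fluxSeries φ := by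
  have hQ : Q = X * derivative ℂ φ + X * derivative ℂ φ * Q := by
    ext n
    rw [map_add, coeff_X_mul_derivative, coeff_mul, h n]
    simp only [coeff_X_mul_derivative]
  rw [fluxSeries, PowerSeries.eq_mul_inv_iff_mul_eq (constantCoeff_one_sub_X_mul_ne_zero _)]
  linear_combination hQ

theorem hasDerivAt_duhamel (a : ℝ) {r : ℝ → ℂ} (hr : Continuous r) (t : ℝ) :
    HasDerivAt (fun t : ℝ => -(Real.exp (-(a * t)) • ∫ s in (0 : ℝ)..t, Real.exp (a * s) • r s))
      (-(a * -(Real.exp (-(a * t)) • ∫ s in (0 : ℝ)..t, Real.exp (a * s) • r s) + r t)) t := by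
  have hexp : HasDerivAt (fun s : ℝ => Real.exp (-(a * s))) (Real.exp (-(a * t)) * -a) t := by
    simpa using (((hasDerivAt_id t).const_mul a).neg).exp
  have hc : Continuous fun s : ℝ => Real.exp (a * s) • r s := by fun_prop
  have hi := intervalIntegral.integral_hasDerivAt_right (hc.intervalIntegrable 0 t)
    (hc.stronglyMeasurableAtFilter _ _) hc.continuousAt
  refine (hexp.smul hi).neg.congr_deriv ?_
  rw [smul_smul, ← Real.exp_add, neg_add_cancel, Real.exp_zero, one_smul]
  simp only [Complex.real_smul]
  push_cast
  ring

theorem exists_isFormalSolution (ε : ℝ) : ∃ φ, IsFormalSolution ε φ := by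
  obtain ⟨s, hs⟩ := exists_strong_recursion (α := (ℝ → ℂ) × (ℝ → ℂ))
    (fun n s =>
      let K : ℝ → ℂ := fun t => ∑ x ∈ Finset.HasAntidiagonal.antidiagonal n,
        ((x.1 : ℂ) * (s x.1).1 t) * (s x.2).2 t
      let b : ℝ → ℂ := if n = 0 then 0 else fun t =>
        -(Real.exp (-(ε * n * (n + 1) * t)) • ∫ τ in (0 : ℝ)..t, Real.exp (ε * n * (n + 1) * τ) •
          ((if n = 1 then 1 else 0) + ε * (n + 1) * K τ))
      (b, fun t => n * b t + K t))
  set b : ℕ → ℝ → ℂ := fun n => (s n).1 with hb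
  set q : ℕ → ℝ → ℂ := fun n => (s n).2 with hq
  set K : ℕ → ℝ → ℂ := fun n t => ∑ x ∈ Finset.HasAntidiagonal.antidiagonal n,
    ((x.1 : ℂ) * b x.1 t) * q x.2 t with hK
  have b0 : b 0 = 0 := by
    simp only [hb]; rw [hs 0]; simp
  have q0 : q 0 = 0 := by
    simp only [hq]; rw [hs 0]; ext t; simp
  -- Truncating below n loses nothing: the terms with an index equal to n are killed by the weight
  -- `x.1 = 0` or by `q 0 = 0`.
  have key : ∀ (n : ℕ) (t : ℝ), ∑ x ∈ Finset.HasAntidiagonal.antidiagonal n,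
        ((x.1 : ℂ) * (if x.1 < n then s x.1 else 0).1 t) * (if x.2 < n then s x.2 else 0).2 t
      = K n t := by
    intro n t
    simp only [hK]
    rw [← sum_antidiagonal_truncate (a := fun i => (i : ℂ) * b i t) (b := fun i => q i t)
      (by simp) (by simp [q0])]
    refine Finset.sum_congr rfl fun x _ => ?_
    congr 1 <;> split_ifs <;> simp [hb, hq]
  simp only [key] at hs
  have hbn : ∀ n, n ≠ 0 → b n = fun t =>
        -(Real.exp (-(ε * n * (n + 1) * t)) • ∫ τ in (0 : ℝ)..t, Real.exp (ε * n * (n + 1) * τ) •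
          ((if n = 1 then 1 else 0) + ε * (n + 1) * K n τ)) := by
    intro n hn
    simp only [hb]
    conv_lhs => rw [hs n]
    simp only [if_neg hn]
  have hqn : ∀ n t, q n t = n * b n t + K n t := by
    intro n t
    simp only [hb, hq]
    conv_lhs => rw [hs n]
    conv_rhs => rw [hs n]
  have hcont : ∀ n, Continuous (b n) ∧ Continuous (q n) ∧ Continuous (K n) := by
    intro n
    induction n using Nat.strong_induction_on with
    | _ n ih =>
    have hKc : Continuous (K n) := by
      refine continuous_finsetSum _ fun x hx => ?_
      rw [Finset.HasAntidiagonal.mem_antidiagonal] at hx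
      rcases Nat.eq_zero_or_pos x.1 with h1 | h1
      · simp [h1, continuous_const]
      rcases Nat.eq_zero_or_pos x.2 with h2 | h2
      · simp [h2, q0, continuous_const]
      exact (continuous_const.mul (ih x.1 (by omega)).1).mul (ih x.2 (by omega)).2.1
    have hbc : Continuous (b n) := by
      rcases Nat.eq_zero_or_pos n with rfl | hn
      · rw [b0]; exact continuous_const
      · rw [hbn n hn.ne', continuous_iff_continuousAt]
        exact fun t => (hasDerivAt_duhamel (ε * n * (n + 1))
          (continuous_const.add (continuous_const.mul hKc)) t).continuousAt
    refine ⟨hbc, ?_, hKc⟩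
    rw [show q n = fun t => n * b n t + K n t from funext (hqn n)]
    fun_prop
  have hderiv : ∀ n t, HasDerivAt (b n)
      (-((if n = 1 then 1 else 0) + ε * (n + 1) * q n t)) t := by
    intro n t
    rcases Nat.eq_zero_or_pos n with rfl | hn
    · simp [b0, q0]
    · have := hasDerivAt_duhamel (ε * n * (n + 1)) (r := fun t => (if n = 1 then 1 else 0)
        + ε * (n + 1) * K n t) (continuous_const.add (continuous_const.mul (hcont n).2.2)) t
      rw [← hbn n hn.ne'] at this
      refine this.congr_deriv ?_
      rw [hqn, congrFun (hbn n hn.ne') t]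
      push_cast
      ring
  have hflux : ∀ t, PowerSeries.mk (fun n => q n t)
      = fluxSeries (PowerSeries.mk fun n => b n t) := by
    intro t
    refine eq_fluxSeries_of_coeff fun n => ?_
    simp only [PowerSeries.coeff_mk]
    exact hqn n t
  refine ⟨fun t => PowerSeries.mk fun n => b n t, ?_, ?_, ?_, ?_⟩
  · intro t _
    simp [b0]
  · intro n
    simp only [PowerSeries.coeff_mk]
    refine ContDiff.contDiffOn (contDiff_one_iff_deriv.2
      ⟨fun t => (hderiv n t).differentiableAt, ?_⟩)
    rw [show deriv (b n) = _ from funext fun t => (hderiv n t).deriv]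
    have := (hcont n).2.1
    fun_prop
  · ext n
    rcases Nat.eq_zero_or_pos n with rfl | hn
    · simp [b0]
    · simp [hbn n hn.ne']
  · intro t ht
    rw [equation_iff]
    intro n
    rw [← hflux]
    simp only [timeDeriv, PowerSeries.coeff_mk]
    exact (hderiv n t).hasDerivWithinAt.derivWithin (uniqueDiffOn_Ici 0 t ht)

/-! ### Calculus of convergent power series -/

/-- The power series `f` converges absolutely in the open disc of radius `r`. -/
def ConvergesOnDisc (r : ℝ) (f : PowerSeries ℂ) : Prop :=
  ∀ z : ℂ, ‖z‖ < r → Summable fun n => ‖PowerSeries.coeff n f * z ^ n‖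

/-- These are two terms of the binomial expansion. With d = b - a this bounds na^{n-1} by b^n/(b-a),
the loss of radius paid for one derivative. -/
theorem add_one_mul_pow_mul_le {r d : ℝ} (hr : 0 ≤ r) (hd : 0 ≤ d) (n : ℕ) :
    (n + 1) * r ^ n * d + r ^ (n + 1) ≤ (r + d) ^ (n + 1) := by
  induction n with
  | zero => simp; linarith
  | succ n ih =>
    rw [pow_succ (r + d)]
    refine le_trans ?_ (mul_le_mul_of_nonneg_right ih (by positivity))
    have : 0 ≤ (n + 1) * r ^ n * d * d := by positivity
    push_cast
    rw [pow_succ r (n + 1), pow_succ r n]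
    nlinarith

namespace ConvergesOnDisc

open PowerSeries

variable {r : ℝ} {f g : PowerSeries ℂ} {z : ℂ}

theorem add (hf : ConvergesOnDisc r f) (hg : ConvergesOnDisc r g) :
    ConvergesOnDisc r (f + g) := by
  intro z hz
  refine Summable.of_nonneg_of_le (fun _ => norm_nonneg _) (fun n => ?_) ((hf z hz).add (hg z hz))
  rw [map_add, add_mul]
  exact norm_add_le _ _

theorem neg (hf : ConvergesOnDisc r f) : ConvergesOnDisc r (-f) := by
  intro z hz
  simpa using hf z hz

theorem sub (hf : ConvergesOnDisc r f) (hg : ConvergesOnDisc r g) :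
    ConvergesOnDisc r (f - g) := by
  rw [sub_eq_add_neg]
  exact hf.add hg.neg

theorem coeff_mul_mul_pow (f g : PowerSeries ℂ) (z : ℂ) (n : ℕ) :
    coeff n (f * g) * z ^ n = ∑ x ∈ Finset.HasAntidiagonal.antidiagonal n,
      coeff x.1 f * z ^ x.1 * (coeff x.2 g * z ^ x.2) := by
  rw [coeff_mul, Finset.sum_mul]
  refine Finset.sum_congr rfl fun x hx => ?_
  rw [← Finset.HasAntidiagonal.mem_antidiagonal.1 hx, pow_add]
  ring

theorem mul (hf : ConvergesOnDisc r f) (hg : ConvergesOnDisc r g) :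
    ConvergesOnDisc r (f * g) := by
  intro z hz
  refine (summable_norm_sum_mul_antidiagonal_of_summable_norm (f := fun n => coeff n f * z ^ n)
    (g := fun n => coeff n g * z ^ n) (hf z hz) (hg z hz)).congr fun n => ?_
  rw [coeff_mul_mul_pow]

theorem const (c : ℂ) : ConvergesOnDisc r (C c) := by
  intro z _
  refine summable_of_ne_finset_zero (s := {0}) fun n hn => ?_
  rw [Finset.mem_singleton] at hn
  simp [coeff_C, hn]

theorem var : ConvergesOnDisc r X := by
  intro z _
  refine summable_of_ne_finset_zero (s := {1}) fun n hn => ?_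
  rw [Finset.mem_singleton] at hn
  simp [coeff_X, hn]

theorem seriesSum_add (hf : ConvergesOnDisc r f) (hg : ConvergesOnDisc r g) (hz : ‖z‖ < r) :
    seriesSum (f + g) z = seriesSum f z + seriesSum g z := by
  simp only [seriesSum, map_add, add_mul]
  exact (hf z hz).of_norm.tsum_add (hg z hz).of_norm

theorem seriesSum_sub (hf : ConvergesOnDisc r f) (hg : ConvergesOnDisc r g) (hz : ‖z‖ < r) :
    seriesSum (f - g) z = seriesSum f z - seriesSum g z := by
  simp only [seriesSum, map_sub, sub_mul]
  exact (hf z hz).of_norm.tsum_sub (hg z hz).of_norm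

theorem seriesSum_mul (hf : ConvergesOnDisc r f) (hg : ConvergesOnDisc r g) (hz : ‖z‖ < r) :
    seriesSum (f * g) z = seriesSum f z * seriesSum g z := by
  refine Eq.trans (tsum_congr fun n => coeff_mul_mul_pow f g z n)
    (tsum_mul_tsum_eq_tsum_sum_antidiagonal_of_summable_norm (f := fun n => coeff n f * z ^ n)
      (g := fun n => coeff n g * z ^ n) (hf z hz) (hg z hz)).symm

theorem seriesSum_C (c z : ℂ) : seriesSum (C c) z = c := by
  rw [seriesSum, tsum_eq_single 0 (fun n hn => by simp [coeff_C, hn])]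
  simp

theorem seriesSum_X (z : ℂ) : seriesSum X z = z := by
  rw [seriesSum, tsum_eq_single 1 (fun n hn => by simp [coeff_X, hn])]
  simp

theorem summable_derivative_bound (hf : ConvergesOnDisc r f) {a : ℝ} (ha : 0 ≤ a) (har : a < r) :
    Summable fun n : ℕ => ‖coeff n f‖ * (n * a ^ (n - 1)) := by
  obtain ⟨b, hab, hbr⟩ := exists_between har
  have hb : 0 < b := ha.trans_lt hab
  have := hf (b : ℂ) (by rwa [Complex.norm_real, Real.norm_of_nonneg hb.le])
  refine Summable.of_nonneg_of_le (fun n => by positivity) (fun n => ?_) (this.div_const (b - a))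
  rw [le_div_iff₀ (by linarith), norm_mul, norm_pow, Complex.norm_real, Real.norm_of_nonneg hb.le,
    mul_assoc]
  refine mul_le_mul_of_nonneg_left ?_ (norm_nonneg _)
  rcases n with _ | n
  · simp
  have := add_one_mul_pow_mul_le ha (sub_nonneg.2 hab.le) n
  rw [add_sub_cancel] at this
  have h2 : 0 ≤ a ^ (n + 1) := by positivity
  rw [Nat.add_sub_cancel]
  push_cast
  linarith

theorem derivative (hf : ConvergesOnDisc r f) : ConvergesOnDisc r (derivative ℂ f) := by
  intro z hz
  refine ((summable_nat_add_iff 1).2 (hf.summable_derivative_bound (norm_nonneg z) hz)).congr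
    fun n => ?_
  rw [coeff_derivative, Nat.add_sub_cancel, norm_mul, norm_mul, norm_pow]
  have : ‖(n : ℂ) + 1‖ = n + 1 := by exact_mod_cast Complex.norm_natCast (n + 1)
  rw [this]
  push_cast
  ring

theorem hasDerivAt (hf : ConvergesOnDisc r f) (hz : ‖z‖ < r) :
    HasDerivAt (seriesSum f) (seriesSum (PowerSeries.derivative ℂ f) z) z := by
  obtain ⟨a, hza, har⟩ := exists_between hz
  have ha : 0 < a := (norm_nonneg z).trans_lt hza
  have hmem : z ∈ Metric.ball (0 : ℂ) a := by simpa using hza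
  have := hasDerivAt_tsum_of_isPreconnected (hf.summable_derivative_bound ha.le har)
    Metric.isOpen_ball (convex_ball (0 : ℂ) a).isPreconnected
    (g := fun n z => coeff n f * z ^ n) (g' := fun n z => coeff n f * (n * z ^ (n - 1)))
    (fun n y _ => (hasDerivAt_pow n y).const_mul _)
    (fun n y hy => by
      rw [norm_mul, norm_mul, norm_pow, Complex.norm_natCast]
      have : ‖y‖ ≤ a := by simpa using (Metric.mem_ball.1 hy).le
      gcongr) hmem (hf z hz).of_norm hmem
  refine this.congr_deriv ?_
  have hs : Summable fun n : ℕ => coeff n f * (n * z ^ (n - 1)) := by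
    refine Summable.of_norm ((hf.summable_derivative_bound (norm_nonneg z) hz).congr fun n => ?_)
    rw [norm_mul, norm_mul, norm_pow, Complex.norm_natCast]
  rw [hs.tsum_eq_zero_add, seriesSum]
  simp only [Nat.cast_zero, zero_mul, mul_zero, zero_add]
  refine tsum_congr fun n => ?_
  rw [coeff_derivative, Nat.add_sub_cancel]
  push_cast
  ring

theorem hasDerivAt_deriv (hf : ConvergesOnDisc r f) (hz : ‖z‖ < r) :
    HasDerivAt (deriv (seriesSum f))
      (seriesSum (PowerSeries.derivative ℂ (PowerSeries.derivative ℂ f)) z) z := by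
  refine (hf.derivative.hasDerivAt hz).congr_of_eventuallyEq ?_
  filter_upwards [continuous_norm.continuousAt.eventually_lt continuousAt_const hz] with w hw
  exact (hf.hasDerivAt hw).deriv

theorem of_bounded {M : ℝ} (hr : 0 < r) (h : ∀ n, ‖coeff n f‖ * r ^ n ≤ M) :
    ConvergesOnDisc r f := by
  intro z hz
  have hq : ‖z‖ / r < 1 := (div_lt_one hr).2 hz
  refine Summable.of_nonneg_of_le (fun _ => norm_nonneg _) (fun n => ?_)
    ((summable_geometric_of_lt_one (by positivity) hq).mul_left M)
  rw [norm_mul, norm_pow, div_pow, ← mul_div_assoc, le_div_iff₀ (by positivity)]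
  nlinarith [mul_le_mul_of_nonneg_right (h n) (show 0 ≤ ‖z‖ ^ n by positivity)]

end ConvergesOnDisc

/-! ### Extension to negative times and the radius -/

/-- A function which is differentiable on `[0, ∞)` extends to a differentiable function on the
line. -/
theorem hasDerivAt_extension {b b' : ℝ → ℂ}
    (hb : ∀ t, 0 ≤ t → HasDerivWithinAt b (b' t) (Set.Ici 0) t) (t : ℝ) :
    HasDerivAt (fun s => if 0 ≤ s then b s else b 0 + s • b' 0) (b' (max t 0)) t := by
  have hlin : ∀ t : ℝ, HasDerivAt (fun s : ℝ => b 0 + s • b' 0) (b' 0) t := fun t => by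
    simpa using ((hasDerivAt_id t).smul_const (b' 0)).const_add (b 0)
  rcases lt_trichotomy t 0 with ht | rfl | ht
  · rw [max_eq_right ht.le]
    refine (hlin t).congr_of_eventuallyEq ?_
    filter_upwards [eventually_lt_nhds ht] with s hs
    rw [if_neg hs.not_ge]
  · rw [max_self]
    have h1 : HasDerivWithinAt (fun s => if 0 ≤ s then b s else b 0 + s • b' 0) (b' 0)
        (Set.Ici 0) 0 :=
      (hb 0 le_rfl).congr (fun s hs => if_pos hs) (if_pos le_rfl)
    have h2 : HasDerivWithinAt (fun s => if 0 ≤ s then b s else b 0 + s • b' 0) (b' 0)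
        (Set.Iic 0) 0 := by
      refine (hlin 0).hasDerivWithinAt.congr (fun s hs => ?_) (by simp)
      rcases (show s ≤ 0 from hs).eq_or_lt with rfl | hs
      · simp
      · rw [if_neg hs.not_ge]
    have := h1.union h2
    rwa [Set.Ici_union_Iic, hasDerivWithinAt_univ] at this
  · rw [max_eq_left ht.le]
    refine ((hb t ht.le).hasDerivAt (Ici_mem_nhds ht)).congr_of_eventuallyEq ?_
    filter_upwards [eventually_gt_nhds ht] with s hs
    rw [if_pos hs.le]

/-- `(√2 - 1)` divided by the radius bound, extended by `0` to `t = 0`. -/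
noncomputable def inverseRadius (ε t : ℝ) : ℝ :=
  (1 - Real.exp (-2 * ε * t)) / (2 * ε) * (√2 + √(1 - Real.exp (-2 * ε * t)))

theorem one_sub_exp_pos {ε t : ℝ} (hε : 0 < ε) (ht : 0 < t) : 0 < 1 - Real.exp (-2 * ε * t) :=
  sub_pos.2 (Real.exp_lt_one_iff.2 (by nlinarith [mul_pos hε ht]))

theorem radiusBound_mul_inverseRadius {ε t : ℝ} (hε : 0 < ε) (ht : 0 < t) :
    radiusBound ε t * inverseRadius ε t = √2 - 1 := by
  have hσ := one_sub_exp_pos hε ht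
  have hη : Real.exp (-4 * ε * t) = Real.exp (-2 * ε * t) ^ 2 := by
    rw [← Real.exp_nat_mul]; congr 1; push_cast; ring
  have hη0 := Real.exp_pos (-2 * ε * t)
  rw [radiusBound, inverseRadius, hη]
  set η := Real.exp (-2 * ε * t) with hη'
  set s := √(1 - η) with hs
  have hs2 : s ^ 2 = 1 - η := Real.sq_sqrt hσ.le
  have hs0 : 0 < s := Real.sqrt_pos.2 hσ
  have h2 : √2 ^ 2 = 2 := Real.sq_sqrt (by norm_num)
  have h20 : 0 < √2 := by positivity
  -- The nested root collapses: η = 1 - s² gives 1 - η/2 + s = (1+s)²/2.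
  have hroot : √(1 - η / 2 + s) = (1 + s) / √2 := by
    rw [Real.sqrt_eq_iff_mul_self_eq_of_pos (by positivity)]
    field_simp
    rw [h2]
    linarith
  have h3 : 1 - η ^ 2 ≠ 0 := by nlinarith
  rw [hroot, ← hs2]
  have hη1 : η = 1 - s ^ 2 := by linarith
  rw [hη1] at h3 ⊢
  field_simp
  have h4 : 1 - (1 - s ^ 2) ^ 2 = s ^ 2 * (2 - s ^ 2) := by ring
  rw [h4]
  linear_combination (s ^ 4 + s ^ 3) * h2

/-- The product form covers t = 0 as well, where `inverseRadius` is 0 and every ρ is admitted. -/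
theorem norm_mul_inverseRadius_lt {ε t : ℝ} {ρ : ℂ} (h : (ε, t, ρ) ∈ convergenceDomain) :
    ‖ρ‖ * inverseRadius ε t < √2 - 1 := by
  obtain ⟨hε, ht, h⟩ := h
  simp only at hε ht h
  have h1 : 1 < √2 := Real.lt_sqrt_of_sq_lt (by norm_num)
  rcases ht.eq_or_lt with rfl | ht
  · simp [inverseRadius, h1]
  have hi : 0 < inverseRadius ε t := by
    have := one_sub_exp_pos hε ht
    unfold inverseRadius
    positivity
  rw [← radiusBound_mul_inverseRadius hε ht]
  exact mul_lt_mul_of_pos_right (h.resolve_left ht.ne') hi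

/-! ### Convergence, differentiability and the equation for the sum -/

namespace IsFormalSolution

open PowerSeries

variable {ε t r : ℝ} {φ : ℝ → PowerSeries ℂ}

/-- The hypothesis on r says lr ≤ y, so c_n = f_n(σ)y^n works for t > 0. It also serves the flux,
since g_n ≤ 2f_n + 1 and y ≤ 1. At t = 0 everything vanishes and c = 0 suffices. -/
theorem exists_majorant (h : IsFormalSolution ε φ) (hε : 0 < ε) (ht : 0 ≤ t) (hr : 0 ≤ r)
    (hrt : r * inverseRadius ε t ≤ √2 - 1) :
    ∃ c : ℕ → ℝ, (∀ n, 0 ≤ c n) ∧ (∀ n : ℕ, ‖(n : ℂ) * coeff n (φ t)‖ * r ^ n ≤ c n) ∧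
      (∀ n, ‖coeff n (fluxSeries (φ t))‖ * r ^ n ≤ 2 * c n + 1) ∧
      ∀ N, ∑ n ∈ Finset.range N, c n ≤ 1 / 2 := by
  rcases ht.eq_or_lt with rfl | ht'
  · refine ⟨fun _ => 0, by simp, ?_, ?_, by simp⟩
    · simp [h.initial]
    · intro n
      simp [h.initial, fluxSeries]
  obtain ⟨f, g, hfg⟩ := exists_isMajorantPair
  have hσ := one_sub_exp_pos hε ht'
  have hb := fun n => h.norm_coeff_le hε hfg n t ht
  unfold inverseRadius at hrt
  have hη0 := Real.exp_pos (-2 * ε * t)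
  set σ := 1 - Real.exp (-2 * ε * t) with hσ'
  have hσ1 : σ ≤ 1 := by linarith
  have hs0 : 0 < √σ := Real.sqrt_pos.2 hσ
  have hs1 : √σ ≤ 1 := Real.sqrt_le_one.2 hσ1
  have hs2 : √σ ^ 2 = σ := Real.sq_sqrt hσ.le
  have h1 : 1 < √2 := Real.lt_sqrt_of_sq_lt (by norm_num)
  have h2 : √2 ≤ 1.5 := Real.sqrt_le_iff.2 (by norm_num)
  set y := (√2 - 1) / (√2 + √σ) with hy
  have hl0 : 0 ≤ σ / (2 * ε) := by positivity
  have hly : σ / (2 * ε) * r ≤ y := by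
    rw [hy, le_div_iff₀ (by positivity)]
    linarith
  have hy0 : 0 ≤ y := (mul_nonneg hl0 hr).trans hly
  have hy1 : y ≤ 1 := by
    rw [hy, div_le_one (by positivity)]
    linarith
  have hpow : ∀ n, (σ / (2 * ε)) ^ n * r ^ n ≤ y ^ n := fun n => by
    rw [← mul_pow]
    exact pow_le_pow_left₀ (mul_nonneg hl0 hr) hly n
  have hf := hfg.f_nonneg hσ.le hσ1
  refine ⟨fun n => (f n).eval σ * y ^ n, fun n => mul_nonneg (hf n) (by positivity), ?_, ?_, ?_⟩
  · intro n
    refine (mul_le_mul_of_nonneg_right (hb n).1 (by positivity)).trans ?_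
    rw [mul_assoc]
    exact mul_le_mul_of_nonneg_left (hpow n) (hf n)
  · intro n
    have hg : 0 ≤ (g n).eval σ ∧ (g n).eval σ ≤ 2 * (f n).eval σ + 1 := by
      rcases Nat.lt_or_ge n 2 with hn | hn
      · interval_cases n
        · simp [hfg.f_zero, hfg.g_zero]
        · simp [hfg.f_one, hfg.g_one]
      · rw [hfg.g_eq hn]
        have := hf n
        simp
        constructor <;> linarith
    refine (mul_le_mul_of_nonneg_right (hb n).2 (by positivity)).trans ?_
    rw [mul_assoc]
    refine (mul_le_mul_of_nonneg_left (hpow n) hg.1).trans ?_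
    have hyn : 0 ≤ y ^ n := by positivity
    have hyn1 : y ^ n ≤ 1 := pow_le_one₀ hy0 hy1
    nlinarith [mul_le_mul_of_nonneg_right hg.2 hyn]
  · intro N
    have := hfg.sum_range_le hs0 hs1 N
    rwa [hs2] at this

theorem sum_range_norm_le (h : IsFormalSolution ε φ) (hε : 0 < ε) (ht : 0 ≤ t) (hr : 0 ≤ r)
    (hrt : r * inverseRadius ε t ≤ √2 - 1) (N : ℕ) :
    ∑ n ∈ Finset.range N, ‖(n : ℂ) * coeff n (φ t)‖ * r ^ n ≤ 1 / 2 := by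
  obtain ⟨c, -, h1, -, h2⟩ := h.exists_majorant hε ht hr hrt
  exact (Finset.sum_le_sum fun n _ => h1 n).trans (h2 N)

theorem norm_coeff_mul_pow_le (h : IsFormalSolution ε φ) (hε : 0 < ε) (ht : 0 ≤ t) (hr : 0 ≤ r)
    (hrt : r * inverseRadius ε t ≤ √2 - 1) (n : ℕ) : ‖coeff n (φ t)‖ * r ^ n ≤ 1 / 2 := by
  rcases Nat.eq_zero_or_pos n with rfl | hn
  · rw [h.constCoeff_zero t ht]; simp
  have h1 := Finset.single_le_sum (f := fun n : ℕ => ‖(n : ℂ) * coeff n (φ t)‖ * r ^ n)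
    (fun n _ => by positivity) (Finset.self_mem_range_succ n)
  have h2 := h.sum_range_norm_le hε ht hr hrt (n + 1)
  refine le_trans ?_ (h1.trans h2)
  simp only [norm_mul, Complex.norm_natCast]
  have : (1 : ℝ) ≤ n := by exact_mod_cast hn
  have h3 : 0 ≤ ‖coeff n (φ t)‖ := norm_nonneg _
  gcongr
  nlinarith

theorem norm_coeff_fluxSeries_mul_pow_le (h : IsFormalSolution ε φ) (hε : 0 < ε) (ht : 0 ≤ t)
    (hr : 0 ≤ r) (hrt : r * inverseRadius ε t ≤ √2 - 1) (n : ℕ) :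
    ‖coeff n (fluxSeries (φ t))‖ * r ^ n ≤ 2 := by
  obtain ⟨c, h0, -, h1, h2⟩ := h.exists_majorant hε ht hr hrt
  have h3 := (Finset.single_le_sum (fun n _ => h0 n) (Finset.self_mem_range_succ n)).trans
    (h2 (n + 1))
  linarith [h1 n]

theorem summable_natCast_mul (h : IsFormalSolution ε φ) (hε : 0 < ε) (ht : 0 ≤ t) (hr : 0 ≤ r)
    (hrt : r * inverseRadius ε t ≤ √2 - 1) :
    Summable (fun n : ℕ => ‖(n : ℂ) * coeff n (φ t)‖ * r ^ n) ∧
      ∑' n : ℕ, ‖(n : ℂ) * coeff n (φ t)‖ * r ^ n ≤ 1 / 2 := by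
  have h0 : ∀ n : ℕ, 0 ≤ ‖(n : ℂ) * coeff n (φ t)‖ * r ^ n := fun n => by positivity
  exact ⟨summable_of_sum_range_le h0 (h.sum_range_norm_le hε ht hr hrt),
    Real.tsum_le_of_sum_range_le h0 (h.sum_range_norm_le hε ht hr hrt)⟩

theorem norm_le_natCast_mul (h : IsFormalSolution ε φ) (ht : 0 ≤ t) (ρ : ℂ) (n : ℕ) :
    ‖coeff n (φ t) * ρ ^ n‖ ≤ ‖(n : ℂ) * coeff n (φ t)‖ * ‖ρ‖ ^ n := by
  rcases Nat.eq_zero_or_pos n with rfl | hn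
  · rw [h.constCoeff_zero t ht]; simp
  have : (1 : ℝ) ≤ n := by exact_mod_cast hn
  rw [norm_mul, norm_mul, norm_pow, Complex.norm_natCast]
  have h3 : 0 ≤ ‖coeff n (φ t)‖ := norm_nonneg _
  gcongr
  nlinarith

/-- For n ≥ N one has 1 ≤ n/N, so the weight n in the summable majorant yields the factor 1/N, with
no dependence on the parameters. -/
theorem norm_seriesSum_sub_le (h : IsFormalSolution ε φ) (hε : 0 < ε) (ht : 0 ≤ t) {ρ : ℂ}
    (hρ : ‖ρ‖ * inverseRadius ε t ≤ √2 - 1) {N : ℕ} (hN : 0 < N) :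
    ‖seriesSum (φ t) ρ - ∑ n ∈ Finset.range N, coeff n (φ t) * ρ ^ n‖ ≤ 1 / 2 / N := by
  obtain ⟨h1, h2⟩ := h.summable_natCast_mul hε ht (norm_nonneg ρ) hρ
  have hs : Summable fun n => coeff n (φ t) * ρ ^ n :=
    Summable.of_norm_bounded h1 (h.norm_le_natCast_mul ht ρ)
  have hN' : (0 : ℝ) < N := by exact_mod_cast hN
  rw [seriesSum, ← hs.sum_add_tsum_nat_add N, add_sub_cancel_left]
  have h3 := (summable_nat_add_iff N).2 h1
  refine (tsum_of_norm_bounded (h3.div_const (N : ℝ)).hasSum fun n => ?_).trans ?_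
  · rw [le_div_iff₀ hN', norm_mul, norm_mul, norm_pow, Complex.norm_natCast, mul_comm _ (N : ℝ),
      ← mul_assoc]
    have : (N : ℝ) ≤ ((n + N : ℕ) : ℝ) := by exact_mod_cast Nat.le_add_left N n
    gcongr
  · rw [tsum_div_const]
    refine div_le_div_of_nonneg_right (le_trans ?_ h2) hN'.le
    rw [← h1.sum_add_tsum_nat_add N]
    exact le_add_of_nonneg_left (Finset.sum_nonneg fun n _ => by positivity)

theorem convergesOnDisc (h : IsFormalSolution ε φ) (hε : 0 < ε) (ht : 0 ≤ t) (hr : 0 < r)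
    (hrt : r * inverseRadius ε t ≤ √2 - 1) : ConvergesOnDisc r (φ t) :=
  .of_bounded hr (h.norm_coeff_mul_pow_le hε ht hr.le hrt)

theorem timeDeriv_eq (h : IsFormalSolution ε φ) (ht : 0 ≤ t) :
    timeDeriv φ t = -(X + C (ε : ℂ) * derivative ℂ (X * fluxSeries (φ t))) := by
  have := h.equation t ht
  rw [nonlinearity_eq] at this
  linear_combination this

theorem convergesOnDisc_timeDeriv (h : IsFormalSolution ε φ) (hε : 0 < ε) (ht : 0 ≤ t)
    (hr : 0 < r) (hrt : r * inverseRadius ε t ≤ √2 - 1) :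
    ConvergesOnDisc r (timeDeriv φ t) := by
  rw [h.timeDeriv_eq ht]
  have hq : ConvergesOnDisc r (fluxSeries (φ t)) :=
    .of_bounded hr (h.norm_coeff_fluxSeries_mul_pow_le hε ht hr.le hrt)
  exact (ConvergesOnDisc.var.add ((ConvergesOnDisc.const _).mul
    (ConvergesOnDisc.var.mul hq).derivative)).neg

/-- By continuity of `inverseRadius` the radius r > ‖ρ‖ stays admissible near t, so |q_n|r^n ≤ 2
holds there uniformly and the differentiated series is dominated by 2ε(n+1)(‖ρ‖/r)^n, up to the
degree-one term. -/
theorem hasDerivWithinAt_seriesSum (h : IsFormalSolution ε φ) (hε : 0 < ε) (ht : 0 ≤ t) {ρ : ℂ}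
    (hρr : ‖ρ‖ < r) (hrt : r * inverseRadius ε t < √2 - 1) :
    HasDerivWithinAt (fun s => seriesSum (φ s) ρ) (seriesSum (timeDeriv φ t) ρ) (Set.Ici 0) t := by
  have hr : 0 < r := (norm_nonneg ρ).trans_lt hρr
  have hcont : Continuous fun s => r * inverseRadius ε (max s 0) := by
    unfold inverseRadius
    fun_prop
  have hopen : IsOpen {s | r * inverseRadius ε (max s 0) < √2 - 1} :=
    isOpen_lt hcont continuous_const
  have htm : t ∈ {s | r * inverseRadius ε (max s 0) < √2 - 1} := by
    rwa [Set.mem_ofPred_eq, max_eq_left ht]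
  obtain ⟨δ, hδ, hball⟩ := Metric.isOpen_iff.1 hopen t htm
  have htδ := Metric.mem_ball_self hδ (x := t)
  set b' : ℕ → ℝ → ℂ := fun n s => coeff n (timeDeriv φ s) with hb'
  have hb'eq : ∀ n s, 0 ≤ s → b' n s
      = -((if n = 1 then 1 else 0) + ε * (n + 1) * coeff n (fluxSeries (φ s))) :=
    fun n s hs => (equation_iff ε (φ s) (timeDeriv φ s)).1 (h.equation s hs) n
  have hb : ∀ n s, 0 ≤ s → HasDerivWithinAt (fun s => coeff n (φ s)) (b' n s) (Set.Ici 0) s := by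
    intro n s hs
    rw [hb'eq n s hs]
    exact h.hasDerivWithinAt_coeff n hs
  set u : ℕ → ℝ := fun n => (if n = 1 then ‖ρ‖ else 0)
    + 2 * ε * ((n : ℝ) ^ 1 * (‖ρ‖ / r) ^ n + (‖ρ‖ / r) ^ n) with hu
  have hq1 : ‖ρ‖ / r < 1 := (div_lt_one hr).2 hρr
  have hq0 : 0 ≤ ‖ρ‖ / r := by positivity
  have husum : Summable u := by
    refine Summable.add ?_ (Summable.mul_left _ (Summable.add ?_ ?_))
    · refine summable_of_ne_finset_zero (s := {1}) fun n hn => ?_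
      rw [Finset.mem_singleton] at hn
      simp [hn]
    · exact summable_pow_mul_geometric_of_norm_lt_one 1 (by rwa [Real.norm_of_nonneg hq0])
    · exact summable_geometric_of_lt_one hq0 hq1
  -- Termwise differentiation needs an open interval around t, even for t = 0; hence the affine
  -- continuation of each coefficient to negative times.
  have main := hasDerivAt_tsum_of_isPreconnected husum Metric.isOpen_ball
    (convex_ball t δ).isPreconnected
    (g := fun n s => (if 0 ≤ s then coeff n (φ s) else coeff n (φ 0) + s • b' n 0) * ρ ^ n)
    (g' := fun n s => b' n (max s 0) * ρ ^ n)
    (fun n s _ => (hasDerivAt_extension (hb n) s).mul_const _)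
    (fun n s hs => by
      have hq := h.norm_coeff_fluxSeries_mul_pow_le hε (le_max_right s 0) hr.le (hball hs).le n
      rw [hb'eq n _ (le_max_right s 0), norm_mul, norm_neg, norm_pow]
      refine (mul_le_mul_of_nonneg_right (norm_add_le _ _) (by positivity)).trans ?_
      rw [add_mul, hu]
      refine add_le_add ?_ ?_
      · split_ifs with h1
        · simp [h1]
        · simp
      · have e : ‖(n : ℂ) + 1‖ = n + 1 := by exact_mod_cast Complex.norm_natCast (n + 1)
        rw [norm_mul, norm_mul, Complex.norm_real, Real.norm_of_nonneg hε.le, e]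
        have e2 : ‖ρ‖ ^ n = (‖ρ‖ / r) ^ n * r ^ n := by
          rw [← mul_pow, div_mul_cancel₀ _ hr.ne']
        rw [e2]
        have hc : 0 ≤ ε * (n + 1) * (‖ρ‖ / r) ^ n := by positivity
        nlinarith [mul_le_mul_of_nonneg_left hq hc])
    htδ (by
      simp only [if_pos ht]
      exact (h.convergesOnDisc hε ht hr hrt.le ρ hρr).of_norm) htδ
  rw [max_eq_left ht] at main
  refine (main.hasDerivWithinAt (s := Set.Ici 0)).congr (fun s hs => ?_) ?_
  · simp only [seriesSum, if_pos (show 0 ≤ s from hs)]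
  · simp only [seriesSum, if_pos ht]

theorem solvesEquationAt (h : IsFormalSolution ε φ) (hε : 0 < ε) (ht : 0 ≤ t) {ρ : ℂ}
    (hρ : ‖ρ‖ * inverseRadius ε t < √2 - 1) :
    SolvesEquationAt ε (fun s z => seriesSum (φ s) z) t ρ := by
  obtain ⟨r, hρr, hrt⟩ : ∃ r, ‖ρ‖ < r ∧ r * inverseRadius ε t < √2 - 1 := by
    have hc : ContinuousAt (fun r => r * inverseRadius ε t) ‖ρ‖ := by fun_prop
    have h1 := (hc.eventually_lt continuousAt_const hρ).filter_mono
      (nhdsWithin_le_nhds (s := Set.Ioi ‖ρ‖))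
    obtain ⟨r, h2, h3⟩ := ((eventually_mem_nhdsWithin).and h1).exists
    exact ⟨r, h2, h3⟩
  have hr : 0 < r := (norm_nonneg ρ).trans_lt hρr
  have hφ := h.convergesOnDisc hε ht hr hrt.le
  have hd := h.convergesOnDisc_timeDeriv hε ht hr hrt.le
  have hX : ConvergesOnDisc r X := .var
  have h1 : ConvergesOnDisc r 1 := by simpa using ConvergesOnDisc.const (r := r) 1
  have hε' : ConvergesOnDisc r (C (ε : ℂ)) := .const _
  have s1 : seriesSum 1 ρ = 1 := by simpa using ConvergesOnDisc.seriesSum_C 1 ρ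
  have hp := hX.mul hφ.derivative
  have hP := h1.sub hp
  have sP : seriesSum (1 - X * PowerSeries.derivative ℂ (φ t)) ρ
      = 1 - ρ * seriesSum (PowerSeries.derivative ℂ (φ t)) ρ := by
    rw [h1.seriesSum_sub hp hρr, hX.seriesSum_mul hφ.derivative hρr, s1,
      ConvergesOnDisc.seriesSum_X]
  have hne : 1 - ρ * seriesSum (PowerSeries.derivative ℂ (φ t)) ρ ≠ 0 := by
    obtain ⟨a1, a2⟩ := h.summable_natCast_mul hε ht (norm_nonneg ρ) hρ.le
    have : ‖seriesSum (X * PowerSeries.derivative ℂ (φ t)) ρ‖ ≤ 1 / 2 := by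
      refine (tsum_of_norm_bounded a1.hasSum fun n => ?_).trans a2
      rw [coeff_X_mul_derivative, norm_mul, norm_pow]
    rw [hX.seriesSum_mul hφ.derivative hρr, ConvergesOnDisc.seriesSum_X] at this
    intro h0
    rw [← sub_eq_zero.1 h0, norm_one] at this
    norm_num at this
  refine ⟨_, _, _, h.hasDerivWithinAt_seriesSum hε ht hρr hrt, hφ.hasDerivAt hρr,
    hφ.hasDerivAt_deriv hρr, hne, ?_⟩
  have hN := hX.mul (hX.mul hφ.derivative.derivative)
  -- Multiplying by (1-p)² removes the inverse, so that only sums and products of convergent series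
  -- have to be evaluated at ρ.
  have eq : (timeDeriv φ t + X - C (ε : ℂ)) * ((1 - X * PowerSeries.derivative ℂ (φ t))
      * (1 - X * PowerSeries.derivative ℂ (φ t)))
      + C (ε : ℂ) * (1 + X * (X * PowerSeries.derivative ℂ
        (PowerSeries.derivative ℂ (φ t)))) = C 0 := by
    have e1 := h.equation t ht
    have e2 : ((1 - X * PowerSeries.derivative ℂ (φ t)) ^ 2)⁻¹
        * (1 - X * PowerSeries.derivative ℂ (φ t)) ^ 2 = 1 :=
      PowerSeries.inv_mul_cancel _ (by simp)
    rw [map_zero]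
    linear_combination (1 - X * PowerSeries.derivative ℂ (φ t)) ^ 2 * e1
      - C (ε : ℂ) * (1 + X ^ 2 * PowerSeries.derivative ℂ
        (PowerSeries.derivative ℂ (φ t))) * e2
  have ev := congrArg (fun f => seriesSum f ρ) eq
  beta_reduce at ev
  rw [(((hd.add hX).sub hε').mul (hP.mul hP)).seriesSum_add (hε'.mul (h1.add hN)) hρr,
    ((hd.add hX).sub hε').seriesSum_mul (hP.mul hP) hρr, (hd.add hX).seriesSum_sub hε' hρr,
    hd.seriesSum_add hX hρr, hP.seriesSum_mul hP hρr, sP, hε'.seriesSum_mul (h1.add hN) hρr,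
    h1.seriesSum_add hN hρr, hX.seriesSum_mul (hX.mul hφ.derivative.derivative) hρr,
    hX.seriesSum_mul hφ.derivative.derivative hρr, s1] at ev
  simp only [ConvergesOnDisc.seriesSum_X, ConvergesOnDisc.seriesSum_C] at ev
  field_simp
  linear_combination ev

end IsFormalSolution

theorem mainTheorem1 :
    ∃ φ : ℝ → ℝ → PowerSeries ℂ,
      (∀ ε : ℝ, 0 < ε →
        IsFormalSolution ε (φ ε) ∧
        ∀ ψ : ℝ → PowerSeries ℂ, IsFormalSolution ε ψ → ∀ t : ℝ, 0 ≤ t → ψ t = φ ε t) ∧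
      (∀ (ε t : ℝ) (ρ : ℂ), (ε, t, ρ) ∈ convergenceDomain →
        Summable fun n : ℕ => ‖PowerSeries.coeff n (φ ε t) * ρ ^ n‖) ∧
      TendstoUniformlyOn
        (fun (N : ℕ) (p : ℝ × ℝ × ℂ) =>
          ∑ n ∈ Finset.range N, PowerSeries.coeff n (φ p.1 p.2.1) * p.2.2 ^ n)
        (fun p : ℝ × ℝ × ℂ => seriesSum (φ p.1 p.2.1) p.2.2)
        Filter.atTop convergenceDomain ∧
      (∀ (ε t : ℝ) (ρ : ℂ), (ε, t, ρ) ∈ convergenceDomain →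
        SolvesEquationAt ε (fun s z => seriesSum (φ ε s) z) t ρ) := by
  choose φ hφ using exists_isFormalSolution
  refine ⟨φ, fun ε _ => ⟨hφ ε, fun ψ hψ t ht => (hφ ε).unique hψ ht⟩, fun ε t ρ h => ?_, ?_,
    fun ε t ρ h => (hφ ε).solvesEquationAt h.1 h.2.1 (norm_mul_inverseRadius_lt h)⟩
  · exact Summable.of_nonneg_of_le (fun _ => norm_nonneg _) ((hφ ε).norm_le_natCast_mul h.2.1 ρ)
      ((hφ ε).summable_natCast_mul h.1 h.2.1 (norm_nonneg ρ) (norm_mul_inverseRadius_lt h).le).1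
  · rw [Metric.tendstoUniformlyOn_iff]
    intro e he
    have hlim : Filter.Tendsto (fun N : ℕ => (1 / 2 : ℝ) / N) Filter.atTop (nhds 0) :=
      tendsto_const_div_atTop_nhds_zero_nat _
    filter_upwards [hlim.eventually_lt_const he, Filter.eventually_gt_atTop 0] with N hN hN0
    rintro ⟨ε, t, ρ⟩ h
    rw [dist_eq_norm]
    exact ((hφ ε).norm_seriesSum_sub_le h.1 h.2.1 (norm_mul_inverseRadius_lt h).le hN0).trans_lt hN
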